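/- Let $(X,\rho)$ be a compact metric space and let $T\colon X\to X$ be a continuous surjective map. For sequences $\underline{x}=(x_i)_{i\ge 0}$ and $\underline{z}=(z_i)_{i\ge 0}$ in $X$ put $$\rho_B(\underline{x},\underline{z})=\limsup_{n\to\infty}\frac1n\sum_{i=0}^{n-1}\rho(x_i,z_i),$$ and for $x,z\in X$ put $\underline{x}_T=(T^i(x))_{i\ge 0}$ and $\rho_B^T(x,z)=\rho_B(\underline{x}_T,\underline{z}_T)$. We say that: - $(X,T)$ has the asymptotic average shadowing property if for every sequence $\underline{x}$ in $X$ with $\limsup_{n\to\infty}\frac1n\sum_{i=0}^{n-1}\rho(T(x_i),x_{i+1})=0$ there is $z\in X$ with $\rho_B(\underline{z}_T,\underline{x})=0$; - $(X,T)$ has the average shadowing property if for every $\varepsilon>0$ there is $\delta>0$ such that, for every sequence $\underline{x}$ in $X$ for which there is $N\ge 1$ with $\frac1n\sum_{i=0}^{n-1}\rho(T(x_{i+k}),x_{i+k+1})<\delta$ for all $n\ge N$ and all $k\ge 0$, there is $z\in X$ with $\rho_B(\underline{z}_T,\underline{x})<\varepsilon$; - $(X,T)$ is Besicovitch complete if for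 every sequence $(z^{(n)})$ in $X$ that is Cauchy with respect to the pseudometric $\rho_B^T$ there is $z\in X$ with $\lim_{n\to\infty}\rho_B^T(z^{(n)},z)=0$. Then $(X,T)$ has the asymptotic average shadowing property if and only if $(X,T)$ is Besicovitch complete and has the average shadowing property. -/

import Mathlib

open Filter Topology

noncomputable section

namespace BesicovitchShadowing

variable {X : Type*} [MetricSpace X] [CompactSpace X]

/-- The Besicovitch pseudometric on sequences:
`ρ_B(x, z) = limsup_n (1/n) ∑_{i<n} ρ(x_i, z_i)`.
As `X` is compact, the averages are bounded, so this real `limsup` is the genuine one. -/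
def besicovitchDist (x z : ℕ → X) : ℝ :=
  limsup (fun n : ℕ => (1 / (n : ℝ)) * ∑ i ∈ Finset.range n, dist (x i) (z i)) atTop

/-- The orbit of `x` under `T`, as a sequence. -/
def orbitSeq (T : X → X) (x : X) : ℕ → X := fun n => T^[n] x

/-- The dynamical Besicovitch pseudometric on `X`. -/
def dynBesicovitchDist (T : X → X) (x z : X) : ℝ :=
  besicovitchDist (orbitSeq T x) (orbitSeq T z)

/-- Cauchy sequences for the dynamical Besicovitch pseudometric. -/
def IsBesicovitchCauchy (T : X → X) (z : ℕ → X) : Prop :=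
  ∀ ε : ℝ, 0 < ε → ∃ N : ℕ, ∀ n m : ℕ, N ≤ n → N ≤ m → dynBesicovitchDist T (z n) (z m) < ε

/-- Completeness with respect to the dynamical Besicovitch pseudometric. -/
def IsBesicovitchComplete (T : X → X) : Prop :=
  ∀ z : ℕ → X, IsBesicovitchCauchy T z →
    ∃ p : X, Tendsto (fun n => dynBesicovitchDist T (z n) p) atTop (𝓝 0)

/-- `δ`-average pseudo-orbits: the averages of the errors over all windows of length at least
some `N` are smaller than `δ`. -/
def IsAveragePseudoOrbit (T : X → X) (δ : ℝ) (x : ℕ → X) : Prop :=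
  ∃ N : ℕ, 1 ≤ N ∧ ∀ n k : ℕ, N ≤ n →
    (1 / (n : ℝ)) * ∑ i ∈ Finset.range n, dist (T (x (i + k))) (x (i + k + 1)) < δ

/-- Asymptotic average pseudo-orbits: the averages of the errors tend to `0`. -/
def IsAsymptoticAveragePseudoOrbit (T : X → X) (x : ℕ → X) : Prop :=
  limsup (fun n : ℕ => (1 / (n : ℝ)) * ∑ i ∈ Finset.range n, dist (T (x i)) (x (i + 1))) atTop = 0

/-- The average shadowing property. -/
def AverageShadowing (T : X → X) : Prop :=
  ∀ ε : ℝ, 0 < ε → ∃ δ : ℝ, 0 < δ ∧ ∀ x : ℕ → X, IsAveragePseudoOrbit T δ x →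
    ∃ z : X, besicovitchDist (orbitSeq T z) x < ε

/-- The asymptotic average shadowing property. -/
def AsymptoticAverageShadowing (T : X → X) : Prop :=
  ∀ x : ℕ → X, IsAsymptoticAveragePseudoOrbit T x →
    ∃ z : X, besicovitchDist (orbitSeq T z) x = 0

end BesicovitchShadowing

end

/-! Both directions rest on changing sequences where the averages barely notice. Asymptotic
shadowing is applied to sequences glued along blocks whose end points at least double
(`exists_sum_le_of_blocks`): each block adds one jump of bounded size, so the gluing costs nothing
on average. For completeness, the k-th block follows the orbit of the k-th term of a Cauchy
sequence, and a point shadowing the result is a limit. For average shadowing, the blocks are ever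
better pseudo-orbits that no orbit `ε`-shadows; compactness makes this failure visible inside each
block (`exists_uniform_window`), so the glued sequence cannot be shadowed. Conversely,
`exists_averagePseudoOrbit` replaces an asymptotic pseudo-orbit by a `δ`-average one at Besicovitch
distance zero. Average shadowing then gives ever better shadowing points; they form a Cauchy
sequence, and its limit shadows exactly. -/

/-- The upper Cesàro mean of a real sequence. -/
noncomputable def upperMean (f : ℕ → ℝ) : ℝ :=
  limsup (fun n : ℕ => (1 / (n : ℝ)) * ∑ i ∈ Finset.range n, f i) atTop

namespace BesicovitchShadowing

/-! ### Cesàro averages and linear bounds on partial sums -/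

theorem cesaro_nonneg {f : ℕ → ℝ} (h0 : ∀ i, 0 ≤ f i) (n : ℕ) :
    0 ≤ (1 / (n : ℝ)) * ∑ i ∈ Finset.range n, f i :=
  mul_nonneg (by positivity) (Finset.sum_nonneg fun i _ => h0 i)

theorem cesaro_le_iff {f : ℕ → ℝ} {c : ℝ} {n : ℕ} (hn : 1 ≤ n) :
    (1 / (n : ℝ)) * ∑ i ∈ Finset.range n, f i ≤ c ↔ ∑ i ∈ Finset.range n, f i ≤ c * n := by
  have : (0 : ℝ) < n := by exact_mod_cast hn
  rw [one_div_mul_eq_div, div_le_iff₀ this]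

theorem isBoundedUnder_cesaro {f : ℕ → ℝ} {D : ℝ} (hD : ∀ i, f i ≤ D) :
    IsBoundedUnder (· ≤ ·) atTop
      (fun n : ℕ => (1 / (n : ℝ)) * ∑ i ∈ Finset.range n, f i) := by
  refine isBoundedUnder_of_eventually_le (a := D) ?_
  filter_upwards [eventually_ge_atTop 1] with n hn
  rw [cesaro_le_iff hn]
  calc ∑ i ∈ Finset.range n, f i ≤ ∑ _i ∈ Finset.range n, D := Finset.sum_le_sum fun i _ => hD i
    _ = D * n := by simp [mul_comm]

theorem isCoboundedUnder_cesaro {f : ℕ → ℝ} (h0 : ∀ i, 0 ≤ f i) :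
    IsCoboundedUnder (· ≤ ·) atTop
      (fun n : ℕ => (1 / (n : ℝ)) * ∑ i ∈ Finset.range n, f i) :=
  (isBoundedUnder_of_eventually_ge
    (Eventually.of_forall (cesaro_nonneg h0))).isCoboundedUnder_flip

theorem exists_sum_le_of_upperMean_lt {f : ℕ → ℝ} {D c : ℝ} (hD : ∀ i, f i ≤ D)
    (h : upperMean f < c) : ∃ N : ℕ, ∀ n, N ≤ n → ∑ i ∈ Finset.range n, f i ≤ c * n := by
  have h1 := eventually_lt_of_limsup_lt h (isBoundedUnder_cesaro hD)
  obtain ⟨N, hN⟩ := eventually_atTop.1 (h1.and (eventually_ge_atTop 1))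
  exact ⟨N, fun n hn => (cesaro_le_iff (hN n hn).2).1 (hN n hn).1.le⟩

theorem upperMean_le {f : ℕ → ℝ} {c : ℝ} (h0 : ∀ i, 0 ≤ f i) {N : ℕ}
    (h : ∀ n, N ≤ n → ∑ i ∈ Finset.range n, f i ≤ c * n) : upperMean f ≤ c := by
  refine limsup_le_of_le (isCoboundedUnder_cesaro h0) ?_
  filter_upwards [eventually_ge_atTop 1, eventually_ge_atTop N] with n hn hN
  exact (cesaro_le_iff hn).2 (h n hN)

theorem upperMean_nonneg {f : ℕ → ℝ} {D : ℝ} (h0 : ∀ i, 0 ≤ f i) (hD : ∀ i, f i ≤ D) :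
    0 ≤ upperMean f :=
  le_limsup_of_frequently_le (Frequently.of_forall (cesaro_nonneg h0)) (isBoundedUnder_cesaro hD)

theorem upperMean_eq_zero {f : ℕ → ℝ} {D : ℝ} (h0 : ∀ i, 0 ≤ f i) (hD : ∀ i, f i ≤ D)
    (h : ∀ ε : ℝ, 0 < ε → ∃ N : ℕ, ∀ n, N ≤ n → ∑ i ∈ Finset.range n, f i ≤ ε * n) :
    upperMean f = 0 := by
  refine le_antisymm (le_of_forall_pos_le_add fun ε hε => ?_) (upperMean_nonneg h0 hD)
  obtain ⟨N, hN⟩ := h ε hε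
  simpa using upperMean_le h0 hN

/-! ### Blocks and gluing -/

/-- Bounds for the partial sums inside blocks of exponentially growing end points give a bound
for all partial sums. -/
theorem exists_sum_le_of_blocks {g : ℕ → ℝ} {m : ℕ → ℕ} (hm : ∀ k, 2 * m k + 1 ≤ m (k + 1))
    {ε : ℝ} (hε : 0 < ε) {K : ℕ}
    (h : ∀ k, K ≤ k → ∀ n, m k ≤ n → n ≤ m (k + 1) → ∑ i ∈ Finset.Ico (m k) n, g i ≤ ε * n) :
    ∃ N : ℕ, ∀ n, N ≤ n → ∑ i ∈ Finset.range n, g i ≤ 4 * ε * n := by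
  have hmono : StrictMono m := strictMono_nat_of_lt_succ fun k => by have := hm k; omega
  set C := ∑ i ∈ Finset.range (m K), g i
  -- The constant 2 reproduces itself: the end points double, so `2 * ε * m k + ε * m (k + 1) ≤ 2 *
  -- ε * m (k + 1)`.
  have key : ∀ k, K ≤ k → ∑ i ∈ Finset.range (m k), g i ≤ C + 2 * ε * m k := by
    intro k hk
    induction k, hk using Nat.le_induction with
    | base => have : 0 ≤ 2 * ε * m K := by positivity
              linarith
    | succ k hk ih =>
      have h1 := h k hk (m (k + 1)) (hmono k.lt_succ_self).le le_rfl
      rw [← Finset.sum_range_add_sum_Ico g (hmono k.lt_succ_self).le]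
      have h2 : (2 * m k + 1 : ℝ) ≤ m (k + 1) := by exact_mod_cast hm k
      nlinarith
  obtain ⟨N, hN⟩ := exists_nat_ge (C / ε)
  refine ⟨max N (m K), fun n hn => ?_⟩
  have hKn : m K ≤ n := le_trans (le_max_right _ _) hn
  have hex : ∃ k, n < m (k + 1) := ⟨n, lt_of_lt_of_le n.lt_succ_self (hmono.le_apply)⟩
  classical
  set k := Nat.find hex with hkdef
  have hk1 : n < m (k + 1) := Nat.find_spec hex
  have hKk : K ≤ k := by
    by_contra hlt
    have : m (k + 1) ≤ m K := hmono.monotone (by omega)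
    omega
  have hk0 : m k ≤ n := by
    rcases Nat.eq_or_lt_of_le hKk with h' | h'
    · rwa [← h']
    · have := Nat.find_min hex (m := k - 1) (by omega)
      rw [Nat.sub_add_cancel (by omega)] at this
      omega
  rw [← Finset.sum_range_add_sum_Ico g hk0]
  have h1 := h k hKk n hk0 hk1.le
  have h2 := key k hKk
  have h3 : (m k : ℝ) ≤ n := by exact_mod_cast hk0
  have h4 : C ≤ ε * n := by
    rw [div_le_iff₀ hε] at hN
    have : (N : ℝ) ≤ n := by exact_mod_cast le_trans (le_max_left _ _) hn
    nlinarith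
  nlinarith

theorem sum_Ico_mul_le {f : ℕ → ℝ} {L : ℕ} {C : ℝ}
    (h : ∀ b, ∑ i ∈ Finset.Ico (b * L) ((b + 1) * L), f i ≤ C) (a c : ℕ) :
    ∑ i ∈ Finset.Ico (a * L) ((a + c) * L), f i ≤ c * C := by
  induction c with
  | zero => simp
  | succ c ih =>
    rw [← Finset.sum_Ico_consecutive f (n := (a + c) * L) (Nat.mul_le_mul_right _ (by omega))
      (Nat.mul_le_mul_right _ (by omega))]
    have := h (a + c)
    push_cast
    rw [add_mul (c : ℝ), one_mul]
    exact add_le_add ih this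

theorem exists_glued {X : Type*} {m : ℕ → ℕ} (hm : StrictMono m) (u : ℕ → ℕ → X) :
    ∃ y : ℕ → X, ∀ k i, m k ≤ i → i < m (k + 1) → y i = u k i := by
  classical
  have hex : ∀ i, ∃ k, i < m (k + 1) := fun i => ⟨i, lt_of_lt_of_le i.lt_succ_self hm.le_apply⟩
  refine ⟨fun i => u (Nat.find (hex i)) i, fun k i h1 h2 => ?_⟩
  have : Nat.find (hex i) = k := by
    rw [Nat.find_eq_iff]
    refine ⟨h2, fun l hl hlt => ?_⟩
    have : m (l + 1) ≤ m k := hm.monotone (by omega)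
    omega
  simp only [this]

/-- The initial value is left open: upper means ignore the finitely many indices before the first
block. -/
theorem exists_rec_sequence (F : ℕ → ℕ → ℕ) :
    ∃ m : ℕ → ℕ, ∀ k, m (k + 1) = F k (m k) :=
  ⟨fun n => Nat.rec 0 (fun k a => F k a) n, fun _ => rfl⟩

/-! ### The Besicovitch pseudometric and errors of glued sequences -/

theorem besicovitchDist_comm {X : Type*} [MetricSpace X] (x z : ℕ → X) :
    besicovitchDist x z = besicovitchDist z x := by
  simp only [besicovitchDist, dist_comm]

theorem dist_map_orbit {X : Type*} [MetricSpace X] (T : X → X) (z : X) (i : ℕ) :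
    dist (T (T^[i] z)) (T^[i + 1] z) = 0 := by
  rw [Function.iterate_succ_apply', dist_self]

section

variable {X : Type*} [MetricSpace X] [CompactSpace X]

theorem dist_le_diam_univ (x y : X) : dist x y ≤ Metric.diam (Set.univ : Set X) :=
  Metric.dist_le_diam_of_mem isCompact_univ.isBounded (Set.mem_univ x) (Set.mem_univ y)

theorem besicovitchDist_nonneg (x z : ℕ → X) : 0 ≤ besicovitchDist x z :=
  upperMean_nonneg (fun _ => dist_nonneg) fun _ => dist_le_diam_univ _ _

theorem besicovitchDist_triangle (x y z : ℕ → X) :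
    besicovitchDist x z ≤ besicovitchDist x y + besicovitchDist y z := by
  refine le_of_forall_pos_le_add fun ε hε => ?_
  obtain ⟨N, hN⟩ := exists_sum_le_of_upperMean_lt (f := fun i => dist (x i) (y i))
    (c := besicovitchDist x y + ε / 2) (fun _ => dist_le_diam_univ _ _)
    (by change besicovitchDist x y < _; linarith)
  obtain ⟨M, hM⟩ := exists_sum_le_of_upperMean_lt (f := fun i => dist (y i) (z i))
    (c := besicovitchDist y z + ε / 2) (fun _ => dist_le_diam_univ _ _)
    (by change besicovitchDist y z < _; linarith)
  refine upperMean_le (f := fun i => dist (x i) (z i)) (N := max N M) (fun _ => dist_nonneg) ?_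
  intro n hn
  have h1 := hN n (le_trans (le_max_left _ _) hn)
  have h2 := hM n (le_trans (le_max_right _ _) hn)
  have h3 : ∑ i ∈ Finset.range n, dist (x i) (z i) ≤
      ∑ i ∈ Finset.range n, dist (x i) (y i) + ∑ i ∈ Finset.range n, dist (y i) (z i) := by
    rw [← Finset.sum_add_distrib]
    exact Finset.sum_le_sum fun i _ => dist_triangle _ _ _
  linarith

/-- Inside a block, gluing adds at most one jump to the pseudo-orbit errors. -/
theorem sum_error_glued_le (T : X → X) {a b : ℕ} {y v : ℕ → X}
    (h : ∀ i, a ≤ i → i < b → y i = v i) {n : ℕ} (ha : a ≤ n) (hb : n ≤ b) :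
    ∑ i ∈ Finset.Ico a n, dist (T (y i)) (y (i + 1)) ≤
      ∑ i ∈ Finset.Ico a n, dist (T (v i)) (v (i + 1)) + Metric.diam (Set.univ : Set X) := by
  rcases Nat.eq_or_lt_of_le ha with rfl | hlt
  · simpa using Metric.diam_nonneg
  · obtain ⟨l, rfl⟩ : ∃ l, n = l + 1 := ⟨n - 1, by omega⟩
    rw [Finset.sum_Ico_succ_top (by omega), Finset.sum_Ico_succ_top (by omega)]
    have h1 : ∑ i ∈ Finset.Ico a l, dist (T (y i)) (y (i + 1)) =
        ∑ i ∈ Finset.Ico a l, dist (T (v i)) (v (i + 1)) := by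
      refine Finset.sum_congr rfl fun i hi => ?_
      rw [Finset.mem_Ico] at hi
      rw [h i hi.1 (by omega), h (i + 1) (by omega) (by omega)]
    have h2 := dist_le_diam_univ (T (y l)) (y (l + 1))
    have h3 : 0 ≤ dist (T (v l)) (v (l + 1)) := dist_nonneg
    linarith

/-! ### Asymptotic average shadowing implies completeness -/

theorem isBesicovitchComplete_of_asymptotic {T : X → X} (hA : AsymptoticAverageShadowing T) :
    IsBesicovitchComplete T := by
  intro z hz
  set D := Metric.diam (Set.univ : Set X)
  -- One threshold serves all `j ≤ k`, so that the block following `z k` can be compared with every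
  -- earlier `z j`.
  have hM : ∀ k : ℕ, ∃ M : ℕ, ∀ j ≤ k, ∀ n, M ≤ n →
      ∑ i ∈ Finset.range n, dist (T^[i] (z j)) (T^[i] (z k)) ≤
        (dynBesicovitchDist T (z j) (z k) + 1 / ((k : ℝ) + 1)) * n := by
    intro k
    have h1 : ∀ j, ∃ M : ℕ, ∀ n, M ≤ n →
      ∑ i ∈ Finset.range n, dist (T^[i] (z j)) (T^[i] (z k)) ≤
        (dynBesicovitchDist T (z j) (z k) + 1 / ((k : ℝ) + 1)) * n := fun j =>
      exists_sum_le_of_upperMean_lt (f := fun i => dist (T^[i] (z j)) (T^[i] (z k)))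
        (fun _ => dist_le_diam_univ _ _)
        (lt_add_of_pos_right (dynBesicovitchDist T (z j) (z k)) (by positivity))
    choose M hM using h1
    refine ⟨(Finset.range (k + 1)).sup M, fun j hj n hn => hM j n (le_trans ?_ hn)⟩
    exact Finset.le_sup (Finset.mem_range.2 (by omega))
  choose M hM using hM
  obtain ⟨m, hm⟩ := exists_rec_sequence fun k a => max (2 * a + 1) (M (k + 1))
  have hm2 : ∀ k, 2 * m k + 1 ≤ m (k + 1) := fun k => by rw [hm]; exact le_max_left _ _
  have hmM : ∀ k, 1 ≤ k → M k ≤ m k := by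
    intro k hk
    obtain ⟨l, rfl⟩ : ∃ l, k = l + 1 := ⟨k - 1, by omega⟩
    rw [hm]; exact le_max_right _ _
  have hmono : StrictMono m := strictMono_nat_of_lt_succ fun k => by have := hm2 k; omega
  obtain ⟨y, hy⟩ := exists_glued hmono fun k i => T^[i] (z k)
  have hyA : IsAsymptoticAveragePseudoOrbit T y := by
    refine upperMean_eq_zero (f := fun i => dist (T (y i)) (y (i + 1)))
      (fun _ => dist_nonneg) (fun _ => dist_le_diam_univ _ _) fun ε hε => ?_
    obtain ⟨K, hK⟩ := exists_nat_ge (D / (ε / 4))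
    obtain ⟨N, hN⟩ := exists_sum_le_of_blocks (g := fun i => dist (T (y i)) (y (i + 1))) hm2
      (ε := ε / 4) (by positivity) (K := K) (by
        intro k hk n h1 h2
        refine (sum_error_glued_le T (hy k) h1 h2).trans ?_
        rw [Finset.sum_eq_zero fun i _ => dist_map_orbit T (z k) i, zero_add]
        rw [div_le_iff₀ (by positivity)] at hK
        have : (K : ℝ) ≤ n := by exact_mod_cast hk.trans (hmono.le_apply.trans h1)
        nlinarith)
    exact ⟨N, fun n hn => (hN n hn).trans (le_of_eq (by ring))⟩
  obtain ⟨p, hp⟩ := hA y hyA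
  refine ⟨p, Metric.tendsto_atTop.2 fun ε hε => ?_⟩
  -- The Cauchy bound and `1 / (k + 1)` contribute `ε / 16` each; the factor 4 from the block lemma
  -- turns `ε / 8` into `ε / 2`.
  obtain ⟨J, hJ⟩ := hz (ε / 16) (by positivity)
  refine ⟨J, fun j hj => ?_⟩
  obtain ⟨K, hK⟩ := exists_nat_ge (1 / (ε / 16))
  obtain ⟨N, hN⟩ := exists_sum_le_of_blocks (g := fun i => dist (T^[i] (z j)) (y i)) hm2
      (ε := ε / 8) (by positivity) (K := max (max j 1) K) (by
        intro k hk n h1 h2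
        have hkK : K ≤ k := le_trans (le_max_right _ _) hk
        have hkj : j ≤ k := le_trans (le_trans (le_max_left _ _) (le_max_left _ _)) hk
        have hk1 : 1 ≤ k := le_trans (le_trans (le_max_right _ _) (le_max_left _ _)) hk
        have e : ∑ i ∈ Finset.Ico (m k) n, dist (T^[i] (z j)) (y i) =
            ∑ i ∈ Finset.Ico (m k) n, dist (T^[i] (z j)) (T^[i] (z k)) := by
          refine Finset.sum_congr rfl fun i hi => ?_
          rw [Finset.mem_Ico] at hi
          rw [hy k i hi.1 (by omega)]
        have e2 : ∑ i ∈ Finset.Ico (m k) n, dist (T^[i] (z j)) (T^[i] (z k)) ≤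
            ∑ i ∈ Finset.range n, dist (T^[i] (z j)) (T^[i] (z k)) := by
          rw [← Finset.sum_range_add_sum_Ico _ h1]
          exact le_add_of_nonneg_left (Finset.sum_nonneg fun _ _ => dist_nonneg)
        have e3 := hM k j hkj n ((hmM k hk1).trans h1)
        have e4 := hJ j k hj (hj.trans hkj)
        have e5 : 1 / ((k : ℝ) + 1) ≤ ε / 16 := by
          rw [div_le_comm₀ (by positivity) (by positivity)]
          have : (K : ℝ) ≤ k := by exact_mod_cast hkK
          linarith
        rw [e]
        refine (e2.trans e3).trans ?_
        gcongr
        linarith)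
  have h1 : besicovitchDist (orbitSeq T (z j)) y ≤ 4 * (ε / 8) :=
    upperMean_le (f := fun i => dist (T^[i] (z j)) (y i)) (fun _ => dist_nonneg) hN
  have h2 := besicovitchDist_triangle (orbitSeq T (z j)) y (orbitSeq T p)
  rw [besicovitchDist_comm y, hp] at h2
  rw [Real.dist_eq, sub_zero]
  change |besicovitchDist (orbitSeq T (z j)) (orbitSeq T p)| < ε
  rw [abs_of_nonneg (besicovitchDist_nonneg _ _)]
  linarith

/-! ### Asymptotic average shadowing implies average shadowing -/

/-- If no orbit stays `ε`-close on average to `x`, this is witnessed on finite windows of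
uniformly bounded length. -/
theorem exists_uniform_window {T : X → X} (hT : Continuous T) {ε : ℝ} (hε : 0 < ε) {x : ℕ → X}
    (hx : ∀ z, ε ≤ besicovitchDist (orbitSeq T z) x) (a : ℕ) :
    ∃ b : ℕ, ∀ w : X, ∃ n, a ≤ n ∧ n ≤ b ∧
      ε / 2 * n < ∑ i ∈ Finset.range n, dist (T^[i] w) (x i) := by
  have hopen : ∀ n : ℕ, IsOpen {w : X | a ≤ n ∧
      ε / 2 * n < ∑ i ∈ Finset.range n, dist (T^[i] w) (x i)} := by
    intro n
    refine IsOpen.and isOpen_const (isOpen_lt continuous_const ?_)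
    exact continuous_finsetSum _ fun i _ => (hT.iterate i).dist continuous_const
  -- The sets cover `X`: a point outside all of them would have upper mean at most `ε / 2`.
  obtain ⟨t, ht⟩ := isCompact_univ.elim_finite_subcover _ hopen (by
    intro w _
    by_contra hw
    simp only [Set.mem_iUnion, Set.mem_ofPred_eq, not_exists, not_and, not_lt] at hw
    have := upperMean_le (f := fun i => dist (T^[i] w) (x i)) (fun _ => dist_nonneg) hw
    have h2 := hx w
    change ε ≤ upperMean (fun i => dist (T^[i] w) (x i)) at h2
    linarith)
  refine ⟨t.sup id, fun w => ?_⟩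
  have := ht (Set.mem_univ w)
  simp only [Set.mem_iUnion, Set.mem_ofPred_eq] at this
  obtain ⟨n, hn, h1, h2⟩ := this
  exact ⟨n, h1, Finset.le_sup (f := id) hn, h2⟩

theorem averageShadowing_of_asymptotic {T : X → X} (hT : Continuous T)
    (hA : AsymptoticAverageShadowing T) : AverageShadowing T := by
  by_contra hcon
  simp only [AverageShadowing] at hcon
  push Not at hcon
  obtain ⟨ε, hε, hcon⟩ := hcon
  set D := Metric.diam (Set.univ : Set X)
  have hD : 0 ≤ D := Metric.diam_nonneg
  choose x hx hxz using fun k : ℕ => hcon (1 / ((k : ℝ) + 1)) (by positivity)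
  choose N hN1 hN using hx
  choose B hB using fun k a => exists_uniform_window hT hε (hxz k) a
  -- The three bounds give doubling, room in block `k` for the window of failure, and a start of
  -- block `k + 1` so late that its initial `N (k + 1)` uncontrolled terms are negligible.
  obtain ⟨m, hm⟩ := exists_rec_sequence fun k a =>
    max (max (2 * a + 1) (a + B k a)) ((k + 2) * N (k + 1))
  have hm2 : ∀ k, 2 * m k + 1 ≤ m (k + 1) := fun k => by rw [hm]; simp
  have hmB : ∀ k, m k + B k (m k) ≤ m (k + 1) := fun k => by rw [hm]; simp
  have hmN : ∀ k, 1 ≤ k → (k + 1) * N k ≤ m k := by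
    intro k hk
    obtain ⟨l, rfl⟩ : ∃ l, k = l + 1 := ⟨k - 1, by omega⟩
    rw [hm]; exact le_max_right _ _
  have hmono : StrictMono m := strictMono_nat_of_lt_succ fun k => by have := hm2 k; omega
  obtain ⟨y, hy⟩ := exists_glued hmono fun k i => x k (i - m k)
  have hyA : IsAsymptoticAveragePseudoOrbit T y := by
    refine upperMean_eq_zero (f := fun i => dist (T (y i)) (y (i + 1)))
      (fun _ => dist_nonneg) (fun _ => dist_le_diam_univ _ _) fun η hη => ?_
    obtain ⟨K, hK⟩ := exists_nat_ge ((2 * D + 1) / (η / 4))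
    obtain ⟨M, hM⟩ := exists_sum_le_of_blocks (g := fun i => dist (T (y i)) (y (i + 1))) hm2
      (ε := η / 4) (by positivity) (K := max K 1) (by
        intro k hk n h1 h2
        have hkK : K ≤ k := le_trans (le_max_left _ _) hk
        have hk1 : 1 ≤ k := le_trans (le_max_right _ _) hk
        refine (sum_error_glued_le T (hy k) h1 h2).trans ?_
        have hs : ∑ i ∈ Finset.Ico (m k) n, dist (T (x k (i - m k))) (x k (i + 1 - m k)) =
            ∑ i ∈ Finset.range (n - m k), dist (T (x k i)) (x k (i + 1)) := by
          rw [Finset.sum_Ico_eq_sum_range]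
          refine Finset.sum_congr rfl fun i _ => ?_
          rw [show m k + i - m k = i by omega, show m k + i + 1 - m k = i + 1 by omega]
        rw [hs]
        have hkpos : (0 : ℝ) < (k : ℝ) + 1 := by positivity
        have hNk : ((k : ℝ) + 1) * N k ≤ n := by exact_mod_cast (hmN k hk1).trans h1
        have hNk1 : (1 : ℝ) ≤ N k := by exact_mod_cast hN1 k
        -- Long stretches obey the pseudo-orbit bound; short ones have fewer than `N k` terms, and
        -- `(k + 1) * N k ≤ m k ≤ n`.
        have hb : (∑ i ∈ Finset.range (n - m k), dist (T (x k i)) (x k (i + 1))) * (k + 1) ≤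
            (D + 1) * n := by
          rcases le_or_gt (N k) (n - m k) with hc | hc
          · have h3 := hN k (n - m k) 0 hc
            have h4 := (cesaro_le_iff (f := fun i => dist (T (x k (i + 0))) (x k (i + 0 + 1)))
              ((hN1 k).trans hc)).1 h3.le
            simp only [add_zero] at h4
            rw [one_div_mul_eq_div, le_div_iff₀ hkpos] at h4
            have h5 : ((n - m k : ℕ) : ℝ) ≤ n := by exact_mod_cast Nat.sub_le _ _
            nlinarith [mul_nonneg hD (Nat.cast_nonneg (α := ℝ) n)]
          · have h3 : ∑ i ∈ Finset.range (n - m k), dist (T (x k i)) (x k (i + 1)) ≤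
                (n - m k : ℕ) * D := by
              refine (Finset.sum_le_sum fun i _ => dist_le_diam_univ _ _).trans ?_
              simp [D]
            have h4 : ((n - m k : ℕ) : ℝ) ≤ N k := by exact_mod_cast hc.le
            calc _ ≤ ((n - m k : ℕ) * D) * ((k : ℝ) + 1) := by gcongr
              _ ≤ (N k * D) * ((k : ℝ) + 1) := by gcongr
              _ = D * ((k + 1) * N k) := by ring
              _ ≤ D * n := by gcongr
              _ ≤ _ := by nlinarith [Nat.cast_nonneg (α := ℝ) n]
        have hD2 : D * (k + 1) ≤ D * n := by
          gcongr
          nlinarith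
        rw [div_le_iff₀ (by positivity)] at hK
        have hKk : (K : ℝ) ≤ k := by exact_mod_cast hkK
        have h6 : (2 * D + 1) * n ≤ (η / 4 * (k + 1)) * n := by
          gcongr
          nlinarith
        have h7 : (∑ i ∈ Finset.range (n - m k), dist (T (x k i)) (x k (i + 1)) + D) * (k + 1) ≤
            (η / 4 * n) * (k + 1) := by nlinarith
        exact le_of_mul_le_mul_right h7 hkpos)
    exact ⟨M, fun n hn => (hM n hn).trans (le_of_eq (by ring))⟩
  obtain ⟨z, hz⟩ := hA y hyA
  obtain ⟨M, hM⟩ := exists_sum_le_of_upperMean_lt (f := fun i => dist (T^[i] z) (y i))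
    (c := ε / 4) (fun _ => dist_le_diam_univ _ _)
    (by change besicovitchDist (orbitSeq T z) y < _; rw [hz]; positivity)
  set k := max M 1
  have hk1 : 1 ≤ k := le_max_right _ _
  have hkm : k ≤ m k := hmono.le_apply
  -- A window of length `n ≥ m k` gives `m k + n ≤ 2 * n`, so the bound `ε / 4` up to `m k + n`
  -- contradicts the excess over `ε / 2 * n`.
  obtain ⟨n, hn1, hn2, hn3⟩ := hB k (m k) (T^[m k] z)
  have h1 := hM (m k + n) ((le_max_left M 1).trans (hkm.trans (Nat.le_add_right _ _)))
  have h2 : ∑ i ∈ Finset.range n, dist (T^[i] (T^[m k] z)) (x k i) ≤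
      ∑ i ∈ Finset.range (m k + n), dist (T^[i] z) (y i) := by
    rw [Finset.sum_range_add]
    refine le_trans (le_of_eq (Finset.sum_congr rfl fun i hi => ?_))
      (le_add_of_nonneg_left (Finset.sum_nonneg fun _ _ => dist_nonneg))
    rw [Finset.mem_range] at hi
    have := hmB k
    rw [hy k (m k + i) (by omega) (by omega), ← Function.iterate_add_apply,
      Nat.add_comm i, Nat.add_sub_cancel_left]
  have h3 : (m k : ℝ) ≤ n := by exact_mod_cast hn1
  push_cast at h1
  nlinarith

/-! ### Completeness and average shadowing imply asymptotic average shadowing -/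

/-- An asymptotic average pseudo-orbit can be changed on a set of density zero so that it becomes
an average pseudo-orbit: bad blocks are replaced by orbit segments. -/
theorem exists_averagePseudoOrbit {T : X → X} {x : ℕ → X}
    (hx : IsAsymptoticAveragePseudoOrbit T x) {δ : ℝ} (hδ : 0 < δ) :
    ∃ y, IsAveragePseudoOrbit T δ y ∧ besicovitchDist x y = 0 := by
  classical
  set D := Metric.diam (Set.univ : Set X)
  have hD : 0 ≤ D := Metric.diam_nonneg
  -- With blocks this long, one jump per block costs at most `δ / 4` on average.
  obtain ⟨L, hL⟩ := exists_nat_ge (max 1 (D / (δ / 4)))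
  have hL1 : (1 : ℝ) ≤ L := (le_max_left _ _).trans hL
  have hL1' : 1 ≤ L := by exact_mod_cast hL1
  have hLD : D ≤ δ / 4 * L := by
    have := (le_max_right _ _).trans hL
    rw [div_le_iff₀ (by positivity)] at this
    linarith
  have hmono : StrictMono fun b : ℕ => b * L := fun a b h => Nat.mul_lt_mul_of_pos_right h hL1'
  set E : ℕ → ℝ := fun b => ∑ i ∈ Finset.Ico (b * L) ((b + 1) * L), dist (T (x i)) (x (i + 1))
    with hE
  obtain ⟨y, hy⟩ := exists_glued hmono fun b i =>
    if E b ≤ δ / 4 * L then x i else T^[i - b * L] (x (b * L))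
  have hle : ∀ b, b * L ≤ (b + 1) * L := fun b => Nat.mul_le_mul_right _ (by omega)
  refine ⟨y, ?_, ?_⟩
  · have hblock : ∀ b, ∑ i ∈ Finset.Ico (b * L) ((b + 1) * L), dist (T (y i)) (y (i + 1)) ≤
        δ / 4 * L + D := by
      intro b
      refine (sum_error_glued_le T (hy b) (hle b) le_rfl).trans (add_le_add_left ?_ D)
      split_ifs with hb
      · exact hb
      · rw [Finset.sum_eq_zero]
        · positivity
        · intro i hi
          rw [Finset.mem_Ico] at hi
          rw [show i + 1 - b * L = i - b * L + 1 by omega]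
          exact dist_map_orbit T _ _
    -- A window meets at most `n / L + 2` blocks; `N` makes the two extra ones cost less than `δ / 4
    -- * n`, for a total below `3 * δ / 4 * n`.
    obtain ⟨N, hN⟩ := exists_nat_gt ((2 * (δ / 4 * L + D)) / (δ / 4))
    refine ⟨max N 1, le_max_right _ _, fun n k hn => ?_⟩
    have hn1 : 1 ≤ n := (le_max_right _ _).trans hn
    have hnN : (N : ℝ) ≤ n := by exact_mod_cast (le_max_left _ _).trans hn
    have hn0 : (0 : ℝ) < n := by exact_mod_cast hn1
    have h1 := sum_Ico_mul_le hblock (k / L) (n / L + 2)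
    have h2 : ∑ i ∈ Finset.range n, dist (T (y (i + k))) (y (i + k + 1)) ≤
        ∑ i ∈ Finset.Ico (k / L * L) ((k / L + (n / L + 2)) * L),
          dist (T (y i)) (y (i + 1)) := by
      have : ∑ i ∈ Finset.range n, dist (T (y (i + k))) (y (i + k + 1)) =
          ∑ i ∈ Finset.Ico k (k + n), dist (T (y i)) (y (i + 1)) := by
        rw [Finset.sum_Ico_eq_sum_range, Nat.add_sub_cancel_left]
        simp only [Nat.add_comm k]
      rw [this]
      refine Finset.sum_le_sum_of_subset_of_nonneg (Finset.Ico_subset_Ico ?_ ?_)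
        fun _ _ _ => dist_nonneg
      · exact Nat.div_mul_le_self k L
      · have h3 := Nat.lt_div_mul_add (a := k) hL1'
        have h4 := Nat.lt_div_mul_add (a := n) hL1'
        nlinarith
    have h3 : ((n / L : ℕ) : ℝ) * L ≤ n := by exact_mod_cast Nat.div_mul_le_self n L
    have h4 : ((n / L : ℕ) : ℝ) * D ≤ ((n / L : ℕ) : ℝ) * (δ / 4 * L) := by gcongr
    rw [div_lt_iff₀ (by positivity)] at hN
    push_cast at h1
    rw [one_div_mul_eq_div, div_lt_iff₀ hn0]
    nlinarith
  · refine upperMean_eq_zero (f := fun i => dist (x i) (y i)) (fun _ => dist_nonneg)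
      (fun _ => dist_le_diam_univ _ _) fun ε hε => ?_
    -- Markov's inequality blockwise: `x` and `y` agree on good blocks, while a bad block has error
    -- above `δ / 4 * L` and discrepancy at most `L * D`.
    have hblock : ∀ b, ∑ i ∈ Finset.Ico (b * L) ((b + 1) * L),
        (δ / 4 * dist (x i) (y i) - D * dist (T (x i)) (x (i + 1))) ≤ 0 := by
      intro b
      rw [Finset.sum_sub_distrib, ← Finset.mul_sum, ← Finset.mul_sum, sub_nonpos]
      change _ ≤ D * E b
      by_cases hb : E b ≤ δ / 4 * L
      · rw [Finset.sum_eq_zero, mul_zero]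
        · exact mul_nonneg hD (Finset.sum_nonneg fun _ _ => dist_nonneg)
        · intro i hi
          rw [Finset.mem_Ico] at hi
          rw [hy b i hi.1 hi.2, if_pos hb, dist_self]
      · have h1 : ∑ i ∈ Finset.Ico (b * L) ((b + 1) * L), dist (x i) (y i) ≤ L * D := by
          refine (Finset.sum_le_sum fun i _ => dist_le_diam_univ _ _).trans (le_of_eq ?_)
          rw [Finset.sum_const, Nat.card_Ico, add_mul, one_mul, Nat.add_sub_cancel_left,
            nsmul_eq_mul]
        push Not at hb
        nlinarith
    -- The 2 pays for rounding `n ≥ L` up to whole blocks; `D + 1` avoids dividing by zero.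
    obtain ⟨N, hN⟩ := exists_sum_le_of_upperMean_lt (f := fun i => dist (T (x i)) (x (i + 1)))
      (c := δ / 4 * ε / (2 * (D + 1))) (fun _ => dist_le_diam_univ _ _)
      (by
        rw [show upperMean (fun i => dist (T (x i)) (x (i + 1))) = 0 from hx]
        positivity)
    refine ⟨max N L, fun n hn => ?_⟩
    have hnL : L ≤ n := (le_max_right _ _).trans hn
    have h1 := sum_Ico_mul_le hblock 0 (n / L + 1)
    have hlow : n ≤ (n / L + 1) * L := by
      have := Nat.lt_div_mul_add (a := n) hL1'
      rw [add_mul, one_mul]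
      exact this.le
    have hup : (n / L + 1) * L ≤ 2 * n := by
      have := Nat.div_mul_le_self n L
      rw [add_mul, one_mul]
      omega
    rw [zero_mul, zero_add, ← Finset.range_eq_Ico, Finset.sum_sub_distrib, ← Finset.mul_sum,
      ← Finset.mul_sum, mul_zero, sub_nonpos] at h1
    have h2 := hN _ ((le_max_left _ _).trans (hn.trans hlow))
    have h3 : ∑ i ∈ Finset.range n, dist (x i) (y i) ≤
        ∑ i ∈ Finset.range ((n / L + 1) * L), dist (x i) (y i) :=
      Finset.sum_le_sum_of_subset_of_nonneg (Finset.range_subset_range.2 hlow)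
        fun _ _ _ => dist_nonneg
    have h4 : (((n / L + 1) * L : ℕ) : ℝ) ≤ 2 * n := by exact_mod_cast hup
    have h5 : δ / 4 * ∑ i ∈ Finset.range n, dist (x i) (y i) ≤ δ / 4 * (ε * n) := by
      calc _ ≤ δ / 4 * ∑ i ∈ Finset.range ((n / L + 1) * L), dist (x i) (y i) := by gcongr
        _ ≤ D * ∑ i ∈ Finset.range ((n / L + 1) * L), dist (T (x i)) (x (i + 1)) := h1
        _ ≤ D * (δ / 4 * ε / (2 * (D + 1)) * (2 * n)) := by
          refine mul_le_mul_of_nonneg_left (h2.trans ?_) hD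
          gcongr
        _ = D / (D + 1) * (δ / 4 * (ε * n)) := by field_simp
        _ ≤ 1 * (δ / 4 * (ε * n)) := by
          gcongr
          rw [div_le_one (by positivity)]
          linarith
        _ = _ := one_mul _
    exact le_of_mul_le_mul_left h5 (by positivity)

theorem asymptoticAverageShadowing_of_complete {T : X → X} (hC : IsBesicovitchComplete T)
    (hS : AverageShadowing T) : AsymptoticAverageShadowing T := by
  intro x hx
  have hz : ∀ n : ℕ, ∃ z, besicovitchDist (orbitSeq T z) x < 1 / ((n : ℝ) + 1) := by
    intro n
    obtain ⟨δ, hδ, h⟩ := hS (1 / ((n : ℝ) + 1)) (by positivity)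
    obtain ⟨y, hy, hxy⟩ := exists_averagePseudoOrbit hx hδ
    obtain ⟨z, hz⟩ := h y hy
    refine ⟨z, ?_⟩
    have := besicovitchDist_triangle (orbitSeq T z) y x
    rw [besicovitchDist_comm y, hxy, add_zero] at this
    exact this.trans_lt hz
  choose z hz using hz
  have hlim : Tendsto (fun n => besicovitchDist (orbitSeq T (z n)) x) atTop (𝓝 0) :=
    squeeze_zero (fun _ => besicovitchDist_nonneg _ _) (fun n => (hz n).le)
      tendsto_one_div_add_atTop_nhds_zero_nat
  obtain ⟨p, hp⟩ := hC z (by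
    intro ε hε
    obtain ⟨N, hN⟩ := eventually_atTop.1 (hlim.eventually_lt_const (half_pos hε))
    refine ⟨N, fun n m hn hm => ?_⟩
    have := besicovitchDist_triangle (orbitSeq T (z n)) x (orbitSeq T (z m))
    rw [besicovitchDist_comm x] at this
    have h1 := hN n hn
    have h2 := hN m hm
    change besicovitchDist (orbitSeq T (z n)) (orbitSeq T (z m)) < ε
    linarith)
  refine ⟨p, le_antisymm ?_ (besicovitchDist_nonneg _ _)⟩
  have hsum := hp.add hlim
  rw [add_zero] at hsum
  refine ge_of_tendsto' hsum fun n => ?_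
  have := besicovitchDist_triangle (orbitSeq T p) (orbitSeq T (z n)) x
  rwa [besicovitchDist_comm (orbitSeq T p) (orbitSeq T (z n))] at this

end

end BesicovitchShadowing

theorem theoremC {X : Type*} [MetricSpace X] [CompactSpace X] (T : X → X)
    (hT : Continuous T) (hsurj : Function.Surjective T) :
    BesicovitchShadowing.AsymptoticAverageShadowing T ↔
      (BesicovitchShadowing.IsBesicovitchComplete T ∧
        BesicovitchShadowing.AverageShadowing T) := by
  exact ⟨fun h => ⟨BesicovitchShadowing.isBesicovitchComplete_of_asymptotic h,
    BesicovitchShadowing.averageShadowing_of_asymptotic hT h⟩,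
    fun h => BesicovitchShadowing.asymptoticAverageShadowing_of_complete h.1 h.2⟩
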